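/- For all positive integers $n$ and non-negative integers $k$, we have $$ \det_{0\le i,j\le n-1}\left(\sum_{l=0}^k\binom {i+j+1}{\lfloor\frac {1} {2}(i+j+2-k)\rfloor+l}\right)= \begin{cases} 2n_1+1, &\text{if }n=(k+1)n_1\text{ and }k\equiv1\pmod 4,\\ 1, &\text{if }n=(k+1)n_1\text{ and }k\equiv3\pmod 4,\\ (-1)^{n_1/2}, &\text{if }n=(k+1)n_1\text{, and }k\text{ and }n_1\text{ are even},\\ (-1)^{(k+n_1-1)/2}, &\text{if }n=(k+1)n_1,\ k\text{ is even, and }n_1\text{ is odd},\\ 2n_1+2, &\text{if }n=(k+1)n_1+1\text{ and }k\text{ is odd},\\ 2(-1)^{n_1/2}, &\text{if }n=(k+1)n_1+1\text{, and }k\text{ and }n_1\text{ are even},\\ (-1)^{(k-1)/2}(2n_1+2), &\text{if }n=(k+1)n_1+k\text{ and }k\text{ is odd},\\ 2(-1)^{(k+n_1)/2}, &\text{if }n=(k+1)n_1+k\text{, and }k\text{ and }n_1\text{ are even},\\ 0, &\text{otherwise.} \end{cases} $$ Here a binomial coefficient $\binom mb$ with $b<0$ or $b>m$ is $0$, $n_1=\lfloor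 n/(k+1)\rfloor$ denotes the quotient of the division of $n$ by $k+1$, and the first applicable case gives the value (this matters only for $k=0$ and $k=1$). In particular, for $k=1$ we obtain, for all positive integers $n$, $$ \det_{0\le i,j\le n-1}\left(\binom {i+j+2}{\lfloor\frac {1} {2}(i+j+3)\rfloor}\right)= \det_{0\le i,j\le n-1}\left(\binom {i+j+2}{\lfloor\frac {1} {2}(i+j+2)\rfloor}\right)=n+1 . $$ -/

import Mathlib

/-- The binomial coefficient with a natural upper index `m` and an arbitrary integer lower
index `b`; it is `0` for `b < 0` (and for `b > m`). -/
def intBinom (m : ℕ) (b : ℤ) : ℤ :=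
  if 0 ≤ b then (m.choose b.toNat : ℤ) else 0

/-- The `n × n` Hankel matrix whose entries are the sums of `k + 1` consecutive binomial
coefficients `∑_{l=0}^{k} binom(i+j+1, ⌊(i+j+2-k)/2⌋ + l)`, with `0 ≤ i, j ≤ n - 1`.
The division is integer division by the positive number `2`, so it is the floor, also for a
negative numerator; the subtraction is that of `ℤ`. -/
def binomSumHankel (n k : ℕ) : Matrix (Fin n) (Fin n) ℤ :=
  Matrix.of fun i j =>
    ∑ l ∈ Finset.range (k + 1),
      intBinom ((i : ℕ) + (j : ℕ) + 1)
        ((((i : ℕ) : ℤ) + ((j : ℕ) : ℤ) + 2 - (k : ℤ)) / 2 + (l : ℤ))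

/-- The case distinction for the value of the determinant, as a function of `n`, `k` and `n₁`;
the first applicable case counts. In the exponents, all subtractions and divisions
of natural numbers are exact in the cases where they are used. -/
def hankelCases (n k n₁ : ℕ) : ℤ :=
  if n = (k + 1) * n₁ ∧ k % 4 = 1 then 2 * (n₁ : ℤ) + 1
  else if n = (k + 1) * n₁ ∧ k % 4 = 3 then 1
  else if n = (k + 1) * n₁ ∧ Even k ∧ Even n₁ then (-1) ^ (n₁ / 2)
  else if n = (k + 1) * n₁ ∧ Even k ∧ Odd n₁ then (-1) ^ ((k + n₁ - 1) / 2)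
  else if n = (k + 1) * n₁ + 1 ∧ Odd k then 2 * (n₁ : ℤ) + 2
  else if n = (k + 1) * n₁ + 1 ∧ Even k ∧ Even n₁ then 2 * (-1) ^ (n₁ / 2)
  else if n = (k + 1) * n₁ + k ∧ Odd k then (-1) ^ ((k - 1) / 2) * (2 * (n₁ : ℤ) + 2)
  else if n = (k + 1) * n₁ + k ∧ Even k ∧ Even n₁ then 2 * (-1) ^ ((k + n₁) / 2)
  else 0

/-- The value of the determinant. In each of the cases with `n = (k+1) n₁`, `n = (k+1) n₁ + 1`
(with `k ≥ 1`) or `n = (k+1) n₁ + k`, the number `n₁` is the quotient of the division of `n`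
by `k + 1`; for `k = 0` every `n` is of the form `n = (k+1) n₁`. -/
def hankelValue (n k : ℕ) : ℤ :=
  hankelCases n k (n / (k + 1))

/-!
Let `F = (z + z⁻¹) (z ^ k + z ^ (k - 2) + ⋯ + z ^ (-k))` and let `f s` be the coefficient of `z ^ s`
in `F`. The entries of the Hankel matrix are the sums of the coefficients of `z ^ 0` and `z ^ 1` in
`(z + z⁻¹) ^ (i + j) F`, so replacing powers by monic Chebyshev polynomials in `z + z⁻¹` turns them
into `f (i + j + 1) + f (i - j)`. After the indices are listed as `…, 5, 3, 1, 0, 2, 4, …`, both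
terms depend on one index difference or sum only, and since `f` vanishes on one parity class just
one of them survives: what remains is a Toeplitz matrix in the coefficients of
`(1 + X) (1 + X + ⋯ + X ^ k)`. The dual Jacobi–Trudi identity exchanges its size with its offset,
which is about `(k + 1) / 2`. The new entries are coefficients of the inverse series and form a
staircase with steps of width `k + 1`, so the small matrix sees at most one jump, and differences
of adjacent rows or columns evaluate its determinant.
-/

section Determinants

variable {R : Type*} [CommRing R]

open Polynomial in
theorem det_apply_mul_eq_det_apply_X_pow (Φ : R[X] →ₗ[R] R) (n : ℕ) (p q : Fin n → R[X])
    (hp : ∀ i, (p i).Monic) (hpdeg : ∀ i, (p i).natDegree = i)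
    (hq : ∀ i, (q i).Monic) (hqdeg : ∀ i, (q i).natDegree = i) :
    (Matrix.of fun i j => Φ (p i * q j)).det =
      (Matrix.of fun i j : Fin n => Φ (X ^ ((i : ℕ) + (j : ℕ)))).det := by
  let coeffs (u : Fin n → R[X]) : Matrix (Fin n) (Fin n) R := Matrix.of fun a i => (u i).coeff a
  have expand (f : R[X]) (hf : f.natDegree < n) :
      f = ∑ a : Fin n, f.coeff a • (X : R[X]) ^ (a : ℕ) := by
    conv_lhs => rw [f.as_sum_range' n hf]
    simp only [smul_X_eq_monomial, Fin.sum_univ_eq_sum_range (fun a => monomial a (f.coeff a))]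
  have factor : (Matrix.of fun i j => Φ (p i * q j)) = (coeffs p).transpose *
      (Matrix.of fun i j : Fin n => Φ (X ^ ((i : ℕ) + (j : ℕ)))) * coeffs q := by
    ext i j
    rw [Matrix.of_apply, expand (p i) (by rw [hpdeg]; exact i.2),
      expand (q j) (by rw [hqdeg]; exact j.2), Finset.sum_mul_sum, Finset.sum_comm]
    simp only [Matrix.mul_apply, map_sum, Matrix.transpose_apply, Matrix.of_apply, coeffs,
      Finset.sum_mul, smul_mul_smul_comm, ← pow_add, map_smul, smul_eq_mul]
    exact Finset.sum_congr rfl fun b _ => Finset.sum_congr rfl fun a _ => by ring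
  rw [factor, Matrix.det_mul, Matrix.det_mul, Matrix.det_transpose,
    Matrix.det_matrixOfPolynomials p hpdeg hp, Matrix.det_matrixOfPolynomials q hqdeg hq, one_mul,
    mul_one]

theorem prod_range_neg_one_pow (n : ℕ) :
    ∏ j ∈ Finset.range n, (-1 : ℤˣ) ^ j = (-1) ^ (n / 2) := by
  induction n using Nat.twoStepInduction with
  | zero => simp
  | one => simp
  | more n ih _ =>
    have hodd : (-1 : ℤˣ) ^ (n + (n + 1)) = -1 := Odd.neg_one_pow ⟨n, by ring⟩
    rw [Finset.prod_range_succ, Finset.prod_range_succ, ih, mul_assoc, ← pow_add, hodd,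
      Nat.add_div_right n two_pos, pow_succ]

theorem sign_revPerm (n : ℕ) : Equiv.Perm.sign (Fin.revPerm : Equiv.Perm (Fin n)) =
    (-1) ^ (n / 2) := by
  have allInverted (j : Fin n) : (∏ i ∈ Finset.Iio j,
      if (Fin.revPerm i : Fin n) < Fin.revPerm j then (1 : ℤˣ) else -1) = (-1) ^ (j : ℕ) := by
    rw [← Fin.card_Iio j, ← Finset.prod_const]
    refine Finset.prod_congr rfl fun i hi => if_neg ?_
    rw [Fin.revPerm_apply, Fin.revPerm_apply, Fin.rev_lt_rev]
    exact (Finset.mem_Iio.1 hi).not_gt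
  rw [Equiv.Perm.sign_eq_prod_prod_Iio, Finset.prod_congr rfl fun j _ => allInverted j,
    Fin.prod_univ_eq_prod_range fun j => (-1 : ℤˣ) ^ j, prod_range_neg_one_pow]

theorem det_submatrix_id_rev {n : ℕ} (M : Matrix (Fin n) (Fin n) R) :
    (M.submatrix id Fin.rev).det = (-1) ^ (n / 2) * M.det := by
  change (M.submatrix id (Fin.revPerm : Equiv.Perm (Fin n))).det = _
  simp [Matrix.det_permute', sign_revPerm]

theorem det_submatrix_rev_id {n : ℕ} (M : Matrix (Fin n) (Fin n) R) :
    (M.submatrix Fin.rev id).det = (-1) ^ (n / 2) * M.det := by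
  change (M.submatrix (Fin.revPerm : Equiv.Perm (Fin n)) id).det = _
  simp [Matrix.det_permute, sign_revPerm]

theorem det_toBlocks₂₂_of_mul_eq_one {m n : Type*} [Fintype m] [Fintype n] [DecidableEq m]
    [DecidableEq n] {M N : Matrix (m ⊕ n) (m ⊕ n) R} (h : M * N = 1) :
    M.toBlocks₂₂.det = M.det * N.toBlocks₁₁.det := by
  have hcol : M * Matrix.fromBlocks N.toBlocks₁₁ 0 N.toBlocks₂₁ 1 =
      Matrix.fromBlocks 1 M.toBlocks₁₂ 0 M.toBlocks₂₂ := by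
    rw [← M.fromBlocks_toBlocks, ← N.fromBlocks_toBlocks, Matrix.fromBlocks_multiply,
      ← Matrix.fromBlocks_one, Matrix.fromBlocks_inj] at h
    conv_lhs => rw [← M.fromBlocks_toBlocks]
    simp [Matrix.fromBlocks_multiply, h.1, h.2.2.1]
  simpa using (congrArg Matrix.det hcol).symm

end Determinants

section Toeplitz

open PowerSeries

variable {R : Type*} [CommRing R]

/-- The coefficients of a power series indexed by all integers, with value `0` at negative
indices. -/
noncomputable def intCoeff (φ : R⟦X⟧) (m : ℤ) : R := if 0 ≤ m then coeff m.toNat φ else 0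

theorem intCoeff_natCast (φ : R⟦X⟧) (m : ℕ) : intCoeff φ m = coeff m φ := by
  simp [intCoeff]

theorem intCoeff_of_neg (φ : R⟦X⟧) {m : ℤ} (hm : m < 0) : intCoeff φ m = 0 :=
  if_neg hm.not_ge

theorem coeff_X_pow_mul_eq_intCoeff (φ : R⟦X⟧) (i j : ℕ) :
    coeff i (X ^ j * φ) = intCoeff φ ((i : ℤ) - j) := by
  rw [coeff_X_pow_mul']
  split_ifs with h
  · rw [← Nat.cast_sub h, intCoeff_natCast]
  · rw [intCoeff_of_neg φ (by omega)]

theorem intCoeff_one_add_X_mul (φ : R⟦X⟧) (m : ℤ) :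
    intCoeff ((1 + X) * φ) m = intCoeff φ m + intCoeff φ (m - 1) := by
  rcases lt_or_ge m 0 with hm | hm
  · rw [intCoeff_of_neg _ hm, intCoeff_of_neg _ hm, intCoeff_of_neg _ (by omega), add_zero]
  · lift m to ℕ using hm
    rw [intCoeff_natCast, intCoeff_natCast, add_mul, one_mul, map_add]
    congr 1
    simpa using coeff_X_pow_mul_eq_intCoeff φ m 1

/-- The `n × n` Toeplitz matrix of the coefficients of a power series, with its coefficient of
index `r` on the diagonal. -/
noncomputable def toeplitz (φ : R⟦X⟧) (n r : ℕ) : Matrix (Fin n) (Fin n) R :=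
  Matrix.of fun i j => intCoeff φ (r + (i : ℕ) - (j : ℕ))

theorem toeplitz_zero_mul_toeplitz_zero (φ ψ : R⟦X⟧) (n : ℕ) :
    toeplitz φ n 0 * toeplitz ψ n 0 = toeplitz (φ * ψ) n 0 := by
  ext i j
  simp only [toeplitz, Matrix.mul_apply, Matrix.of_apply, Nat.cast_zero, zero_add]
  rw [← coeff_X_pow_mul_eq_intCoeff, mul_left_comm, coeff_mul,
    Finset.Nat.sum_antidiagonal_eq_sum_range_succ_mk, ← Finset.sum_range_reflect,
    Fin.sum_univ_eq_sum_range
      fun l => intCoeff φ ((i : ℕ) - (l : ℤ)) * intCoeff ψ ((l : ℤ) - (j : ℕ))]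
  refine (Finset.sum_subset (Finset.range_subset_range.2 i.2) fun l _ hl => ?_).symm.trans
    (Finset.sum_congr rfl fun l hl => ?_)
  · rw [intCoeff_of_neg φ (by rw [Finset.mem_range] at hl; omega), zero_mul]
  · have hli : l ≤ i := Nat.le_of_lt_succ (Finset.mem_range.1 hl)
    rw [show (i : ℕ) + 1 - 1 - l = i - l by omega, Nat.sub_sub_self hli,
      coeff_X_pow_mul_eq_intCoeff, ← intCoeff_natCast, Nat.cast_sub hli]

theorem toeplitz_one_zero (n : ℕ) : toeplitz (1 : R⟦X⟧) n 0 = 1 := by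
  ext i j
  simp [toeplitz, ← coeff_X_pow_mul_eq_intCoeff, coeff_X_pow, Matrix.one_apply, Fin.ext_iff]

theorem det_toeplitz_zero (φ : R⟦X⟧) (n : ℕ) :
    (toeplitz φ n 0).det = constantCoeff φ ^ n := by
  rw [Matrix.det_of_isLowerTriangular]
  · simp [toeplitz, intCoeff]
  · intro i j (hij : i < j)
    exact intCoeff_of_neg φ (by simp; omega)

theorem det_toeplitz_rescale_neg_one (φ : R⟦X⟧) (n r : ℕ) :
    (toeplitz (rescale (-1) φ) n r).det = (-1) ^ (n * r) * (toeplitz φ n r).det := by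
  let v : Fin n → R := fun j => (-1) ^ (j : ℕ)
  let w : Fin n → R := fun i => (-1) ^ (r + (i : ℕ))
  have hentry : toeplitz (rescale (-1) φ) n r =
      Matrix.of fun i j => w i * (Matrix.of fun i j => v j * toeplitz φ n r i j) i j := by
    ext i j
    simp only [toeplitz, Matrix.of_apply, v, w]
    rcases le_or_gt (j : ℕ) (r + i) with h | h
    · obtain ⟨m, hm⟩ := Nat.exists_eq_add_of_le h
      have hcast : (r : ℤ) + (i : ℕ) - (j : ℕ) = m := by omega
      rw [hcast, intCoeff_natCast, intCoeff_natCast, coeff_rescale, hm, ← mul_assoc, ← pow_add]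
      congr 1
      exact neg_one_pow_congr (by simp only [parity_simps]; tauto)
    · rw [intCoeff_of_neg _ (by omega), intCoeff_of_neg _ (by omega), mul_zero, mul_zero]
  have hsign : ∏ i, w i * v i = (-1) ^ (n * r) := by
    have hwv (i : Fin n) : w i * v i = (-1) ^ r := by
      rw [← pow_add]
      exact neg_one_pow_congr (by simp only [parity_simps]; tauto)
    simp [hwv, ← pow_mul, mul_comm]
  rw [hentry, Matrix.det_mul_column, Matrix.det_mul_row, ← mul_assoc, ← Finset.prod_mul_distrib,
    hsign]

theorem neg_one_pow_half_add_mul (r n : ℕ) :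
    (-1 : R) ^ ((r + n) / 2) * (-1) ^ (r / 2) * (-1) ^ (r * n) = (-1) ^ (n / 2) := by
  rw [← pow_add, ← pow_add]
  refine neg_one_pow_congr ?_
  have hmul := Nat.mul_mod r n 2
  rcases Nat.mod_two_eq_zero_or_one r with hr | hr <;>
    rcases Nat.mod_two_eq_zero_or_one n with hn | hn <;> rw [hr, hn] at hmul <;>
    simp only [Nat.even_iff] <;> omega

/-- The dual Jacobi–Trudi identity for rectangular shapes. -/
theorem det_toeplitz_eq_det_toeplitz {φ ψ : R⟦X⟧} (h : φ * rescale (-1) ψ = 1) (n r : ℕ) :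
    (toeplitz φ n r).det = constantCoeff φ ^ (n + r) * (toeplitz ψ r n).det := by
  let rows : Fin r ⊕ Fin n ≃ Fin (r + n) := finSumFinEquiv
  let revRows : Fin r ⊕ Fin n ≃ Fin (r + n) := rows.trans Fin.revPerm
  let M := (toeplitz φ (r + n) 0).submatrix rows revRows
  let N := (toeplitz (rescale (-1) ψ) (r + n) 0).submatrix revRows rows
  have hMN : M * N = 1 := by
    rw [Matrix.submatrix_mul_equiv, toeplitz_zero_mul_toeplitz_zero, h, toeplitz_one_zero,
      Matrix.submatrix_one_equiv]
  have hM : M.det = (-1) ^ ((r + n) / 2) * constantCoeff φ ^ (r + n) := by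
    rw [← det_toeplitz_zero, ← det_submatrix_id_rev, ← Matrix.det_submatrix_equiv_self rows]
    rfl
  have hM₂₂ : M.toBlocks₂₂ = (toeplitz φ n r).submatrix id Fin.rev := by
    ext i j
    simp only [M, rows, revRows, toeplitz, Matrix.toBlocks₂₂, Matrix.of_apply,
      Matrix.submatrix_apply, Equiv.trans_apply, Fin.revPerm_apply, finSumFinEquiv_apply_right,
      Fin.val_rev, Fin.val_natAdd, id_eq]
    congr 1
    omega
  have hN₁₁ : N.toBlocks₁₁ = (toeplitz (rescale (-1) ψ) r n).submatrix Fin.rev id := by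
    ext i j
    simp only [N, rows, revRows, toeplitz, Matrix.toBlocks₁₁, Matrix.of_apply,
      Matrix.submatrix_apply, Equiv.trans_apply, Fin.revPerm_apply, finSumFinEquiv_apply_left,
      Fin.val_rev, Fin.val_castAdd, id_eq]
    congr 1
    omega
  have hminor := det_toBlocks₂₂_of_mul_eq_one hMN
  rw [hM, hM₂₂, hN₁₁, det_submatrix_id_rev, det_submatrix_rev_id,
    det_toeplitz_rescale_neg_one] at hminor
  refine (isUnit_one.neg.pow (n / 2)).mul_left_cancel (hminor.trans ?_)
  rw [← neg_one_pow_half_add_mul r n, add_comm n r]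
  ring

end Toeplitz

section NeighborSum

variable {R : Type*} [CommRing R]

/-- Translation by `t` on two-sided sequences. -/
def shift (t : ℤ) : Module.End R (ℤ → R) := LinearMap.funLeft R R (· + t)

theorem shift_apply (t : ℤ) (f : ℤ → R) (s : ℤ) : shift t f s = f (s + t) := rfl

theorem shift_mul_shift (t u : ℤ) : shift t * shift u = shift (R := R) (t + u) := by
  ext f s
  simp only [Module.End.mul_apply, shift_apply, add_assoc]

theorem shift_pow (t : ℤ) (m : ℕ) : shift t ^ m = shift (R := R) (m * t) := by
  induction m with
  | zero => ext f s; simp [shift_apply]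
  | succ m ih => rw [pow_succ, ih, shift_mul_shift, Nat.cast_succ, add_one_mul]

/-- The operator adding the two neighbouring values of a two-sided sequence. On the coefficients
of a Laurent series in `z` it is multiplication by `z + z⁻¹`. -/
def neighborSum : Module.End R (ℤ → R) := shift (-1) + shift 1

theorem neighborSum_apply (f : ℤ → R) (s : ℤ) : neighborSum f s = f (s - 1) + f (s + 1) := rfl

theorem neighborSum_pow_apply (m : ℕ) (f : ℤ → R) (s : ℤ) :
    (neighborSum ^ m) f s = ∑ b ∈ Finset.range (m + 1), m.choose b * f (s + m - 2 * b) := by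
  have hcomm : Commute (shift (R := R) (-1)) (shift 1) := by
    rw [Commute, SemiconjBy, shift_mul_shift, shift_mul_shift, add_comm]
  rw [neighborSum, hcomm.add_pow, LinearMap.sum_apply, Finset.sum_apply]
  refine Finset.sum_congr rfl fun b hb => ?_
  have hbm : b ≤ m := Nat.le_of_lt_succ (Finset.mem_range.1 hb)
  rw [← nsmul_eq_mul', LinearMap.smul_apply, Pi.smul_apply, nsmul_eq_mul, shift_pow, shift_pow,
    shift_mul_shift, shift_apply, Nat.cast_sub hbm]
  congr 2
  ring

theorem even_neighborSum {f : ℤ → R} (hf : f.Even) : (neighborSum f).Even := fun s => by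
  rw [neighborSum_apply, neighborSum_apply, ← hf (s - 1), ← hf (s + 1), add_comm]
  congr 2 <;> ring

open Polynomial

theorem even_aeval_neighborSum {f : ℤ → R} (hf : f.Even) (p : R[X]) :
    (aeval neighborSum p f).Even := by
  induction p using Polynomial.induction_on with
  | C a => simpa using hf.const_smul a
  | add p q hp hq => simpa using hp.add hq
  | monomial m a ih =>
    rw [pow_succ', mul_left_comm, map_mul, aeval_X]
    exact even_neighborSum ih

variable (R) in
/-- The Chebyshev polynomials of the third kind, rescaled so as to be monic: the `j`-th one takes
the value `(z ^ (j + 1) + z ^ (-j)) / (1 + z)` at `z + z⁻¹`. -/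
noncomputable def chebyshevThird : ℕ → R[X]
  | 0 => 1
  | 1 => X - 1
  | j + 2 => X * chebyshevThird (j + 1) - chebyshevThird j

theorem chebyshevThird_monic_and_natDegree [Nontrivial R] (j : ℕ) :
    (chebyshevThird R j).Monic ∧ (chebyshevThird R j).natDegree = j := by
  induction j using Nat.twoStepInduction with
  | zero => exact ⟨monic_one, natDegree_one⟩
  | one =>
    exact ⟨by simpa [chebyshevThird] using monic_X_sub_C (1 : R),
      by simpa [chebyshevThird] using natDegree_X_sub_C (1 : R)⟩
  | more j ih₀ ih₁ =>
    have hdeg : (X * chebyshevThird R (j + 1)).natDegree = j + 2 := by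
      rw [natDegree_X_mul ih₁.1.ne_zero, ih₁.2]
    have hlt : (chebyshevThird R j).natDegree < (X * chebyshevThird R (j + 1)).natDegree := by
      omega
    exact ⟨(monic_X.mul ih₁.1).sub_of_left (degree_lt_degree hlt),
      (natDegree_sub_eq_left_of_natDegree_lt hlt).trans hdeg⟩

theorem aeval_chebyshevThird_add (f : ℤ → R) (j : ℕ) (s : ℤ) :
    aeval neighborSum (chebyshevThird R j) f s + aeval neighborSum (chebyshevThird R j) f (s + 1) =
      f (s + j + 1) + f (s - j) := by
  induction j using Nat.twoStepInduction generalizing s with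
  | zero => simp [chebyshevThird, add_comm]
  | one =>
    simp only [chebyshevThird, map_sub, aeval_X, map_one, LinearMap.sub_apply,
      Module.End.one_apply, Pi.sub_apply, neighborSum_apply, Nat.cast_one, add_sub_cancel_right]
    ring
  | more j ih₀ ih₁ =>
    have hleft := ih₁ (s - 1)
    have hright := ih₁ (s + 1)
    simp only [chebyshevThird, map_sub, map_mul, aeval_X, LinearMap.sub_apply,
      Module.End.mul_apply, Pi.sub_apply, neighborSum_apply]
    rw [sub_add_cancel] at hleft
    rw [add_sub_cancel_right]
    push_cast at *
    rw [show s - 1 + (j + 1) + 1 = s + j + 1 by ring,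
      show s - 1 - ((j : ℤ) + 1) = s - (j + 2) by ring] at hleft
    rw [show s + 1 + ((j : ℤ) + 1) + 1 = s + (j + 2) + 1 by ring,
      show s + 1 - ((j : ℤ) + 1) = s - j by ring] at hright
    linear_combination hleft + hright - ih₀ s

theorem det_hankel_neighborSum {f : ℤ → R} (hf : f.Even) (n : ℕ) :
    (Matrix.of fun i j : Fin n => (neighborSum ^ ((i : ℕ) + (j : ℕ))) f 0 +
      (neighborSum ^ ((i : ℕ) + (j : ℕ))) f 1).det =
    (Matrix.of fun i j : Fin n => f ((i : ℕ) + (j : ℕ) + 1) + f ((i : ℕ) - (j : ℕ))).det := by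
  nontriviality R
  let valueAt (s : ℤ) : (ℤ → R) →ₗ[R] R := LinearMap.proj s
  let Φ : R[X] →ₗ[R] R := (valueAt 0 + valueAt 1) ∘ₗ
    LinearMap.applyₗ f ∘ₗ (aeval neighborSum).toLinearMap
  have hΦ (p : R[X]) : Φ p = aeval neighborSum p f 0 + aeval neighborSum p f 1 := rfl
  have hcheb (i : Fin n) := chebyshevThird_monic_and_natDegree (R := R) i
  have hgram := det_apply_mul_eq_det_apply_X_pow Φ n _ _ (fun i => (hcheb i).1)
    (fun i => (hcheb i).2) (fun i => (hcheb i).1) (fun i => (hcheb i).2)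
  simp only [hΦ, map_pow, aeval_X] at hgram
  rw [← hgram]
  congr 1
  ext i j
  have h := aeval_chebyshevThird_add (aeval neighborSum (chebyshevThird R j) f) i 0
  rw [← Module.End.mul_apply, ← map_mul, zero_add, zero_add, zero_sub,
    even_aeval_neighborSum hf, add_comm (aeval neighborSum (chebyshevThird R j) f _),
    aeval_chebyshevThird_add] at h
  exact h

end NeighborSum

section Zigzag

variable {R : Type*} [CommRing R]

/-- The permutation sending `i` to its position in the list `…, 5, 3, 1, 0, 2, 4, …` of the
elements of `Fin n`. -/
noncomputable def zigzag (n : ℕ) : Equiv.Perm (Fin n) :=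
  Equiv.ofBijective
    (fun i => ⟨if (i : ℕ) % 2 = 0 then n / 2 + i / 2 else n / 2 - (i + 1) / 2, by
      have := i.2
      split_ifs <;> omega⟩)
    (Finite.injective_iff_bijective.1 fun i j hij => by
      have hval := congrArg Fin.val hij
      dsimp only at hval
      have := i.2
      have := j.2
      apply Fin.ext
      split_ifs at hval <;> omega)

theorem eq_two_mul_zigzag_sub_or {n : ℕ} (i : Fin n) :
    ((i : ℕ) : ℤ) = 2 * ((zigzag n i : ℕ) - (n / 2 : ℕ)) ∨
      ((i : ℕ) : ℤ) = -(2 * ((zigzag n i : ℕ) - (n / 2 : ℕ)) + 1) := by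
  have := i.2
  simp only [zigzag, Equiv.ofBijective_apply]
  split_ifs <;> omega

theorem det_toeplitz_add_hankel_eq_det_zigzag {f : ℤ → R} (hf : f.Even) (n : ℕ) :
    (Matrix.of fun i j : Fin n => f ((i : ℕ) + (j : ℕ) + 1) + f ((i : ℕ) - (j : ℕ))).det =
    (Matrix.of fun a b : Fin n => f (2 * ((a : ℕ) - (b : ℕ))) +
      f (2 * ((a : ℕ) + (b : ℕ) - 2 * (n / 2 : ℕ)) + 1)).det := by
  symm
  rw [← Matrix.det_submatrix_equiv_self (zigzag n)]
  congr 1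
  ext i j
  simp only [Matrix.of_apply, Matrix.submatrix_apply]
  generalize hu : ((zigzag n i : ℕ) : ℤ) - (n / 2 : ℕ) = u
  generalize hv : ((zigzag n j : ℕ) : ℤ) - (n / 2 : ℕ) = v
  rw [show ((zigzag n i : ℕ) : ℤ) - (zigzag n j : ℕ) = u - v by omega,
    show ((zigzag n i : ℕ) : ℤ) + (zigzag n j : ℕ) - 2 * (n / 2 : ℕ) = u + v by omega]
  have hi := eq_two_mul_zigzag_sub_or i
  have hj := eq_two_mul_zigzag_sub_or j
  rw [hu] at hi
  rw [hv] at hj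
  rcases hi with hi | hi <;> rcases hj with hj | hj <;> rw [hi, hj]
  · rw [add_comm]
    congr 2 <;> ring
  · congr 2 <;> ring
  · rw [← hf (2 * (u - v)), ← hf (2 * (u + v) + 1)]
    congr 2 <;> ring
  · rw [← hf (2 * (u - v)), ← hf (2 * (u + v) + 1), add_comm]
    congr 2 <;> ring

end Zigzag

section Window

open PowerSeries

/-- The coefficients of `z ^ k + z ^ (k - 2) + ⋯ + z ^ (-k)`. -/
def parityWindow (k : ℕ) (s : ℤ) : ℤ :=
  if -(k : ℤ) ≤ s ∧ s ≤ k ∧ (s - k) % 2 = 0 then 1 else 0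

theorem even_parityWindow (k : ℕ) : (parityWindow k).Even := fun s => by
  simp only [parityWindow]
  exact if_congr (by omega) rfl rfl

theorem sum_intBinom_add (m k : ℕ) (e : ℤ) :
    ∑ l ∈ Finset.range (k + 1), intBinom m (e + l) =
      ∑ b ∈ Finset.range (m + 1), (m.choose b : ℤ) * if e ≤ b ∧ b ≤ e + k then 1 else 0 := by
  have hsingle (c : ℤ) : intBinom m c =
      ∑ b ∈ Finset.range (m + 1), (m.choose b : ℤ) * if (b : ℤ) = c then 1 else 0 := by
    rcases lt_or_ge c 0 with hc | hc
    · rw [intBinom, if_neg hc.not_ge]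
      exact (Finset.sum_eq_zero fun b _ => by rw [if_neg (by omega), mul_zero]).symm
    · lift c to ℕ using hc
      rw [intBinom, if_pos c.cast_nonneg, Int.toNat_natCast]
      simp only [Nat.cast_inj, mul_ite, mul_one, mul_zero, Finset.sum_ite_eq', Finset.mem_range]
      split_ifs with hcm
      · rfl
      · rw [Nat.choose_eq_zero_of_lt (by omega), Nat.cast_zero]
  have hcount (b : ℕ) : (∑ l ∈ Finset.range (k + 1), if (b : ℤ) = e + l then (1 : ℤ) else 0) =
      if e ≤ b ∧ b ≤ e + k then 1 else 0 := by
    split_ifs with hb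
    · obtain ⟨c, hc⟩ := Int.eq_ofNat_of_zero_le (sub_nonneg.2 hb.1)
      rw [Finset.sum_eq_single_of_mem c (Finset.mem_range.2 (by omega))
        fun l _ hl => if_neg (by omega), if_pos (by omega)]
    · refine Finset.sum_eq_zero fun l hl => if_neg ?_
      rw [Finset.mem_range] at hl
      omega
  simp only [hsingle]
  rw [Finset.sum_comm]
  simp only [← Finset.mul_sum, hcount]

theorem neighborSum_pow_parityWindow_add (m k : ℕ) :
    (neighborSum ^ m) (neighborSum (parityWindow k)) 0 +
      (neighborSum ^ m) (neighborSum (parityWindow k)) 1 =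
    ∑ l ∈ Finset.range (k + 1), intBinom (m + 1) (((m : ℤ) + 2 - k) / 2 + l) := by
  rw [← Module.End.mul_apply, ← pow_succ, neighborSum_pow_apply, neighborSum_pow_apply,
    sum_intBinom_add, ← Finset.sum_add_distrib]
  refine Finset.sum_congr rfl fun b _ => ?_
  rw [← mul_add]
  congr 1
  simp only [parityWindow]
  push_cast
  split_ifs <;> first | rfl | omega

theorem det_binomSumHankel_eq_det_zigzag (n k : ℕ) :
    (binomSumHankel n k).det = (Matrix.of fun a b : Fin n =>
      neighborSum (parityWindow k) (2 * ((a : ℕ) - (b : ℕ))) +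
        neighborSum (parityWindow k) (2 * ((a : ℕ) + (b : ℕ) - 2 * (n / 2 : ℕ)) + 1)).det := by
  have heven := even_neighborSum (even_parityWindow k)
  rw [← det_toeplitz_add_hankel_eq_det_zigzag heven, ← det_hankel_neighborSum heven]
  congr 1
  ext i j
  simp only [binomSumHankel, Matrix.of_apply, neighborSum_pow_parityWindow_add, Nat.cast_add]

theorem neighborSum_parityWindow_eq_zero {k : ℕ} {s : ℤ} (hs : (s - k) % 2 = 0) :
    neighborSum (parityWindow k) s = 0 := by
  rw [neighborSum_apply, parityWindow, parityWindow, if_neg (by omega), if_neg (by omega),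
    add_zero]

/-- The polynomial `(1 + X) (1 + X + ⋯ + X ^ (d - 1))`. -/
noncomputable def windowSymbol (d : ℕ) : ℤ⟦X⟧ := (1 + X) * ∑ i ∈ Finset.range d, X ^ i

theorem neighborSum_parityWindow_eq_intCoeff (k : ℕ) (m : ℤ) :
    neighborSum (parityWindow k) (2 * m - (k + 1)) = intCoeff (windowSymbol (k + 1)) m := by
  have hwindow (m : ℤ) :
      intCoeff (∑ i ∈ Finset.range (k + 1), X ^ i : ℤ⟦X⟧) m = parityWindow k (2 * m - k) := by
    rcases lt_or_ge m 0 with hm | hm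
    · rw [intCoeff_of_neg _ hm, parityWindow, if_neg (by omega)]
    · lift m to ℕ using hm
      simp only [intCoeff_natCast, map_sum, coeff_X_pow, Finset.sum_ite_eq, Finset.mem_range,
        parityWindow]
      split_ifs <;> first | rfl | omega
  rw [windowSymbol, intCoeff_one_add_X_mul, hwindow, hwindow, neighborSum_apply, add_comm]
  congr 2 <;> ring

theorem det_binomSumHankel_two_mul_sub_one {k r : ℕ} (hk : k + 1 = 2 * r) (n : ℕ) :
    (binomSumHankel n k).det = (toeplitz (windowSymbol (k + 1)) n r).det := by
  rw [det_binomSumHankel_eq_det_zigzag]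
  congr 1
  ext a b
  rw [Matrix.of_apply, neighborSum_parityWindow_eq_zero (s := _ + 1) (by omega), add_zero,
    toeplitz, Matrix.of_apply, ← neighborSum_parityWindow_eq_intCoeff]
  refine congrArg _ ?_
  omega

theorem det_binomSumHankel_two_mul (n l : ℕ) :
    (binomSumHankel n (2 * l)).det =
      (-1) ^ (n / 2) * (toeplitz (windowSymbol (2 * l + 1)) n (l + n % 2)).det := by
  rw [det_binomSumHankel_eq_det_zigzag, ← det_submatrix_id_rev]
  congr 1
  ext a b
  rw [Matrix.of_apply, neighborSum_parityWindow_eq_zero (s := 2 * _) (by omega), zero_add,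
    toeplitz, Matrix.submatrix_apply, Matrix.of_apply, ← neighborSum_parityWindow_eq_intCoeff,
    Fin.val_rev, id_eq]
  refine congrArg _ ?_
  omega

end Window

section DualSymbol

open PowerSeries

/-- The sum `1 + (-1) ^ d + (-1) ^ (2 * d) + ⋯` with `M` terms. -/
def signSum (d M : ℕ) : ℤ := ∑ q ∈ Finset.range M, ((-1) ^ d) ^ q

theorem signSum_of_even {d : ℕ} (hd : Even d) (M : ℕ) : signSum d M = M := by
  simp [signSum, hd.neg_one_pow]

theorem signSum_of_odd {d : ℕ} (hd : Odd d) (M : ℕ) : signSum d M = if Even M then 0 else 1 := by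
  simp only [signSum, hd.neg_one_pow, neg_one_geom_sum]

/-- The power series `1 / ((1 - X) (1 - (-X) ^ d))`. -/
noncomputable def staircase (d : ℕ) : ℤ⟦X⟧ := mk fun m => signSum d (m / d + 1)

theorem staircase_mul_one_sub_neg_X_pow_mul_one_sub_X {d : ℕ} (hd : 0 < d) :
    staircase d * (1 - (-X) ^ d) * (1 - X) = 1 := by
  suffices hmul : staircase d * (1 - (-X) ^ d) = mk 1 by
    rw [hmul, mk_one_mul_one_sub_eq_one]
  have hpow : (-X : ℤ⟦X⟧) ^ d = C ((-1) ^ d) * X ^ d := by simp [neg_pow X d]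
  ext m
  rw [hpow, mul_sub, mul_one, mul_left_comm, map_sub, coeff_C_mul, coeff_mul_X_pow', staircase,
    coeff_mk, coeff_mk]
  split_ifs with hdm
  · rw [coeff_mk, Nat.div_eq_sub_div hd hdm, signSum, geom_sum_succ, ← signSum,
      add_sub_cancel_left, Pi.one_apply]
  · simp [Nat.div_eq_of_lt (not_le.1 hdm), signSum]

/-- The power series `φ` for which `φ (-X)` is inverse to the window symbol; its coefficients form
a staircase with steps of width `d`. -/
noncomputable def dualSymbol (d : ℕ) : ℤ⟦X⟧ := (1 + X) * staircase d

theorem windowSymbol_mul_rescale_dualSymbol {d : ℕ} (hd : 0 < d) :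
    windowSymbol d * rescale (-1) (dualSymbol d) = 1 := by
  have hX : rescale (-1) (X : ℤ⟦X⟧) = -X := by simp
  have hstair := congrArg (rescale (-1)) (staircase_mul_one_sub_neg_X_pow_mul_one_sub_X hd)
  simp only [map_mul, map_sub, map_pow, map_neg, map_one, hX, neg_neg] at hstair
  have hgeom := geom_sum_mul_neg (X : ℤ⟦X⟧) d
  rw [windowSymbol, dualSymbol, map_mul, map_add, map_one, hX]
  linear_combination hstair + (1 + X) * rescale (-1) (staircase d) * hgeom

theorem constantCoeff_windowSymbol {d : ℕ} (hd : 0 < d) : constantCoeff (windowSymbol d) = 1 := by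
  obtain ⟨d, rfl⟩ := Nat.exists_eq_succ_of_ne_zero hd.ne'
  simp [windowSymbol, Finset.sum_range_succ']

theorem intCoeff_staircase {d : ℕ} (M : ℕ) {t : ℤ} (ht : -d ≤ t) (htd : t < d) :
    intCoeff (staircase d) (d * M + t) = if t < 0 then signSum d M else signSum d (M + 1) := by
  split_ifs with hneg
  · rcases M with - | M
    · rw [intCoeff_of_neg _ (by simpa using hneg), signSum, Finset.sum_range_zero]
    · obtain ⟨u, hu⟩ := Int.eq_ofNat_of_zero_le (show 0 ≤ d + t by omega)
      rw [show (d : ℤ) * (M + 1 : ℕ) + t = (d * M + u : ℕ) by push_cast; linarith,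
        intCoeff_natCast, staircase, coeff_mk, Nat.mul_add_div (by omega),
        Nat.div_eq_of_lt (by omega), add_zero]
  · lift t to ℕ using not_lt.1 hneg
    rw [show (d : ℤ) * M + t = (d * M + t : ℕ) by push_cast; rfl, intCoeff_natCast, staircase,
      coeff_mk, Nat.mul_add_div (by omega), Nat.div_eq_of_lt (by omega), add_zero]

end DualSymbol

section StepToeplitz

variable {R : Type*} [CommRing R]

/-- The two-sided sequence with value `2 a` at negative and `2 c` at positive indices, and the mean
of these values at `0`. -/
def stepValue (a c : R) (s : ℤ) : R := if s < 0 then 2 * a else if s = 0 then a + c else 2 * c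

/-- The `r × r` Toeplitz matrix of the step sequence, with the jump on the diagonal
`i - j = -δ`. -/
def stepToeplitz (a c : R) (δ : ℤ) (r : ℕ) : Matrix (Fin r) (Fin r) R :=
  Matrix.of fun i j => stepValue a c (δ + ((i : ℕ) - (j : ℕ)))

theorem transpose_stepToeplitz (a c : R) (δ : ℤ) (r : ℕ) :
    (stepToeplitz a c δ r).transpose = stepToeplitz c a (-δ) r := by
  ext i j
  simp only [stepToeplitz, stepValue, Matrix.transpose_apply, Matrix.of_apply]
  split_ifs <;> first | omega | ring

theorem det_stepToeplitz_eq_zero (a c : R) {δ : ℤ} {r : ℕ} (hδ : 2 ≤ |δ|) (hr : 2 ≤ r) :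
    (stepToeplitz a c δ r).det = 0 := by
  wlog hpos : 0 ≤ δ generalizing a c δ
  · rw [← Matrix.det_transpose, transpose_stepToeplitz]
    exact this c a (by rwa [abs_neg]) (by omega)
  rw [abs_of_nonneg hpos] at hδ
  refine Matrix.det_zero_of_row_eq (i := ⟨r - 2, by omega⟩) (j := ⟨r - 1, by omega⟩)
    (by simp only [ne_eq, Fin.mk.injEq]; omega) (funext fun j => ?_)
  simp only [stepToeplitz, stepValue, Matrix.of_apply]
  split_ifs <;> first | rfl | omega

theorem det_stepToeplitz_neg_one (a c : R) (r : ℕ) :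
    (stepToeplitz a c (-1) (r + 1)).det = (a - c) ^ r * (2 * a) := by
  let N : Matrix (Fin (r + 1)) (Fin (r + 1)) R := Matrix.of fun i j =>
    if (j : ℕ) = 0 then stepValue a c (-1 + (i : ℕ))
    else if (i : ℕ) = j ∨ (i : ℕ) = j + 1 then a - c else 0
  have hN : (stepToeplitz a c (-1) (r + 1)).det = N.det := by
    refine Matrix.det_eq_of_forall_col_eq_smul_add_pred (fun _ => 1) (fun i => ?_) fun i j => ?_
    · simp [N, stepToeplitz]
    · simp only [N, stepToeplitz, stepValue, Matrix.of_apply, Fin.val_succ, Fin.val_castSucc]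
      push_cast
      split_ifs <;> first | omega | ring
  rw [hN, Matrix.det_of_isLowerTriangular]
  · simp [N, Fin.prod_univ_succ, stepValue, mul_comm]
  · intro i j (hij : i < j)
    simp only [N, Matrix.of_apply]
    rw [if_neg (by omega), if_neg (by omega)]

theorem det_stepToeplitz_one (a c : R) (r : ℕ) :
    (stepToeplitz a c 1 (r + 1)).det = (c - a) ^ r * (2 * c) := by
  rw [← Matrix.det_transpose, transpose_stepToeplitz, det_stepToeplitz_neg_one]

theorem det_firstColumn_superdiagonal {r : ℕ} (v : Fin (r + 1) → R) (x : R) :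
    (Matrix.of fun i j : Fin (r + 1) =>
      if j = 0 then v i else if (i : ℕ) + 1 = j then x else 0).det =
    (-x) ^ r * v (Fin.last r) := by
  rw [Matrix.det_succ_row _ (Fin.last r), Finset.sum_eq_single 0]
  · have hminor : (Matrix.of fun i j : Fin (r + 1) =>
        if j = 0 then v i else if (i : ℕ) + 1 = j then x else 0).submatrix
          (Fin.last r).succAbove (Fin.succAbove 0) = Matrix.diagonal fun _ => x := by
      ext i j
      simp only [Matrix.submatrix_apply, Matrix.of_apply, Fin.succAbove_last, Fin.succAbove_zero,
        Fin.val_castSucc, Fin.val_succ, Fin.val_zero, Nat.add_one_ne_zero, if_false,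
        Nat.add_right_cancel_iff, Matrix.diagonal_apply, Fin.ext_iff]
    rw [hminor, Matrix.det_diagonal]
    simp only [Matrix.of_apply, if_true, Finset.prod_const, Finset.card_univ, Fintype.card_fin,
      Fin.val_last, Fin.val_zero, add_zero]
    rw [neg_pow x, mul_right_comm]
  · intro j _ hj
    rw [Matrix.of_apply, if_neg hj, if_neg (by rw [Fin.val_last]; omega), mul_zero, zero_mul]
  · simp

theorem det_stepToeplitz_zero (a c : R) (r : ℕ) :
    (stepToeplitz a c 0 (r + 1)).det = (c - a) ^ r * (c + (-1) ^ r * a) := by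
  let N : Matrix (Fin (r + 1)) (Fin (r + 1)) R := Matrix.of fun i j =>
    if (j : ℕ) = 0 then stepValue a c (i : ℕ)
    else if (i : ℕ) = j ∨ (i : ℕ) + 1 = j then a - c else 0
  have hN : (stepToeplitz a c 0 (r + 1)).det = N.det := by
    refine Matrix.det_eq_of_forall_col_eq_smul_add_pred (fun _ => 1) (fun i => ?_) fun i j => ?_
    · simp [N, stepToeplitz]
    · simp only [N, stepToeplitz, stepValue, Matrix.of_apply, Fin.val_succ, Fin.val_castSucc]
      push_cast
      split_ifs <;> first | omega | ring
  have hrow := det_firstColumn_superdiagonal (fun i : Fin (r + 1) => c + (-1) ^ (i : ℕ) * a) (a - c)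
  rw [neg_sub, Fin.val_last] at hrow
  rw [hN, ← hrow]
  symm
  refine Matrix.det_eq_of_forall_row_eq_smul_add_pred (fun _ => -1) (fun j => ?_) fun i j => ?_
  · simp only [N, stepValue, Matrix.of_apply, Fin.ext_iff, Fin.val_zero]
    rcases eq_or_ne (j : ℕ) 0 with hj | hj
    · simp [hj, add_comm]
    · simp [hj, hj.symm]
  · simp only [N, stepValue, Matrix.of_apply, Fin.ext_iff, Fin.val_succ, Fin.val_castSucc,
      Fin.val_zero, pow_succ]
    split_ifs <;> first | omega | ring

end StepToeplitz

section Evaluation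

theorem intCoeff_dualSymbol {d : ℕ} (M : ℕ) {s : ℤ} (hs : |s| < d) :
    intCoeff (dualSymbol d) (d * M + s) = stepValue (signSum d M) (signSum d (M + 1)) s := by
  rw [abs_lt] at hs
  rw [dualSymbol, intCoeff_one_add_X_mul, add_sub_assoc,
    intCoeff_staircase M (by omega) (by omega), intCoeff_staircase M (by omega) (by omega),
    stepValue]
  split_ifs <;> omega

theorem det_toeplitz_windowSymbol {d n M r : ℕ} {δ : ℤ} (hd : 0 < d) (hn : (n : ℤ) = d * M + δ)
    (hδ : |δ| + r ≤ d) : (toeplitz (windowSymbol d) n r).det =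
      (stepToeplitz (signSum d M) (signSum d (M + 1)) δ r).det := by
  rw [det_toeplitz_eq_det_toeplitz (windowSymbol_mul_rescale_dualSymbol hd),
    constantCoeff_windowSymbol hd, one_pow, one_mul]
  congr 1
  ext i j
  have hij : |δ + ((i : ℕ) - (j : ℕ))| < d := by
    have := abs_le.1 (le_refl |δ|)
    rw [abs_lt]
    omega
  rw [toeplitz, Matrix.of_apply, stepToeplitz, Matrix.of_apply, ← intCoeff_dualSymbol M hij, hn,
    add_sub_assoc, add_assoc]

theorem det_binomSumHankel_odd_eq_step {n r M : ℕ} {δ : ℤ}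
    (hn : (n : ℤ) = (2 * r + 2) * M + δ) (hδ : |δ| ≤ r + 1) :
    (binomSumHankel n (2 * r + 1)).det = (stepToeplitz (M : ℤ) (M + 1) δ (r + 1)).det := by
  have heven : Even (2 * r + 1 + 1) := ⟨r + 1, by ring⟩
  rw [det_binomSumHankel_two_mul_sub_one (r := r + 1) (by ring),
    det_toeplitz_windowSymbol (M := M) (δ := δ) (by omega) (by push_cast; linarith)
      (by push_cast; linarith), signSum_of_even heven, signSum_of_even heven, Nat.cast_succ]

theorem det_binomSumHankel_even_eq_step {n l M : ℕ} {δ : ℤ}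
    (hn : (n : ℤ) = (2 * l + 1) * M + δ) (hδ : |δ| + (n % 2 : ℕ) ≤ l + 1) :
    (binomSumHankel n (2 * l)).det = (-1) ^ (n / 2) *
      (stepToeplitz (if Even M then 0 else 1) (if Even M then 1 else 0 : ℤ) δ (l + n % 2)).det := by
  have hodd : Odd (2 * l + 1) := ⟨l, rfl⟩
  rw [det_binomSumHankel_two_mul, det_toeplitz_windowSymbol (M := M) (δ := δ) (by omega)
    (by push_cast; linarith) (by push_cast at *; linarith), signSum_of_odd hodd,
    signSum_of_odd hodd]
  simp only [Nat.even_add_one, ite_not]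

theorem hankelValue_mul_add (k q : ℕ) {e : ℕ} (he : e < k + 1) :
    hankelValue ((k + 1) * q + e) k = hankelCases ((k + 1) * q + e) k q := by
  rw [hankelValue, Nat.mul_add_div k.succ_pos, Nat.div_eq_of_lt he, add_zero]

theorem hankelCases_eq_zero (q : ℕ) {k e : ℕ} (he : 2 ≤ e) (hek : e < k) :
    hankelCases ((k + 1) * q + e) k q = 0 := by
  unfold hankelCases
  iterate 8 rw [if_neg (by omega)]

theorem det_binomSumHankel_odd_mul (r q : ℕ) :
    (binomSumHankel ((2 * r + 1 + 1) * q) (2 * r + 1)).det = q + 1 + (-1) ^ r * q := by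
  rw [det_binomSumHankel_odd_eq_step (M := q) (δ := 0) (by push_cast; ring)
    (by rw [abs_zero]; positivity), det_stepToeplitz_zero, add_sub_cancel_left, one_pow, one_mul]

theorem det_binomSumHankel_odd_mul_add_one (r q : ℕ) :
    (binomSumHankel ((2 * r + 1 + 1) * q + 1) (2 * r + 1)).det = 2 * (q + 1) := by
  rw [det_binomSumHankel_odd_eq_step (M := q) (δ := 1) (by push_cast; ring)
    (by rw [abs_one]; linarith), det_stepToeplitz_one, add_sub_cancel_left, one_pow, one_mul]

theorem det_binomSumHankel_odd_mul_add_self (r q : ℕ) :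
    (binomSumHankel ((2 * r + 1 + 1) * q + (2 * r + 1)) (2 * r + 1)).det =
      (-1) ^ r * (2 * (q + 1)) := by
  rw [det_binomSumHankel_odd_eq_step (M := q + 1) (δ := -1) (by push_cast; ring)
    (by rw [abs_neg, abs_one]; linarith), det_stepToeplitz_neg_one, sub_add_cancel_left,
    Nat.cast_succ]

theorem det_binomSumHankel_odd_eq_zero (q : ℕ) {r e : ℕ} (he : 2 ≤ e) (her : e < 2 * r + 1) :
    (binomSumHankel ((2 * r + 1 + 1) * q + e) (2 * r + 1)).det = 0 := by
  rcases le_or_gt e (r + 1) with h | h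
  · rw [det_binomSumHankel_odd_eq_step (M := q) (δ := e) (by push_cast; ring)
      (by rw [abs_of_nonneg] <;> omega)]
    exact det_stepToeplitz_eq_zero _ _ (by rw [abs_of_nonneg] <;> omega) (by omega)
  · rw [det_binomSumHankel_odd_eq_step (M := q + 1) (δ := e - (2 * r + 2)) (by push_cast; ring)
      (by rw [abs_of_nonpos] <;> omega)]
    exact det_stepToeplitz_eq_zero _ _ (by rw [abs_of_nonpos] <;> omega) (by omega)

theorem hankelCases_odd_mul (r q : ℕ) :
    hankelCases ((2 * r + 1 + 1) * q) (2 * r + 1) q = q + 1 + (-1) ^ r * q := by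
  rcases Nat.even_or_odd' r with ⟨m, rfl | rfl⟩
  · rw [hankelCases, if_pos (by omega), (even_two_mul m).neg_one_pow]
    ring
  · rw [hankelCases, if_neg (by omega), if_pos (by omega), (odd_two_mul_add_one m).neg_one_pow]
    ring

theorem hankelCases_odd_mul_add_one (r q : ℕ) :
    hankelCases ((2 * r + 1 + 1) * q + 1) (2 * r + 1) q = 2 * (q + 1) := by
  rw [hankelCases]
  iterate 4 rw [if_neg (by omega)]
  rw [if_pos ⟨rfl, odd_two_mul_add_one r⟩, mul_add_one]

theorem hankelCases_odd_mul_add_self {r : ℕ} (hr : 0 < r) (q : ℕ) :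
    hankelCases ((2 * r + 1 + 1) * q + (2 * r + 1)) (2 * r + 1) q =
      (-1) ^ r * (2 * (q + 1)) := by
  rw [hankelCases]
  iterate 5 rw [if_neg (by omega)]
  rw [if_neg (by omega), if_pos ⟨rfl, odd_two_mul_add_one r⟩, Nat.add_sub_cancel,
    Nat.mul_div_cancel_left r two_pos, mul_add_one]

theorem det_binomSumHankel_odd (n r : ℕ) :
    (binomSumHankel n (2 * r + 1)).det = hankelValue n (2 * r + 1) := by
  obtain ⟨q, e, he, rfl⟩ : ∃ q e, e < 2 * r + 1 + 1 ∧ n = (2 * r + 1 + 1) * q + e :=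
    ⟨_, _, Nat.mod_lt _ (by omega), (Nat.div_add_mod n _).symm⟩
  rw [hankelValue_mul_add (2 * r + 1) q he]
  obtain rfl | rfl | ⟨hr, rfl⟩ | ⟨he₂, her⟩ :
    e = 0 ∨ e = 1 ∨ 0 < r ∧ e = 2 * r + 1 ∨ 2 ≤ e ∧ e < 2 * r + 1 := by omega
  · rw [add_zero, det_binomSumHankel_odd_mul, hankelCases_odd_mul]
  · rw [det_binomSumHankel_odd_mul_add_one, hankelCases_odd_mul_add_one]
  · rw [det_binomSumHankel_odd_mul_add_self, hankelCases_odd_mul_add_self hr]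
  · rw [det_binomSumHankel_odd_eq_zero q he₂ her, hankelCases_eq_zero q he₂ her]

theorem det_binomSumHankel_even_mul (l q : ℕ) :
    (binomSumHankel ((2 * l + 1) * q) (2 * l)).det = (-1) ^ ((2 * l + 1) * q / 2) := by
  rw [det_binomSumHankel_even_eq_step (M := q) (δ := 0) (by push_cast; ring)
    (by rw [abs_zero]; omega)]
  rcases Nat.even_or_odd' q with ⟨m, rfl | rfl⟩
  · rw [show (2 * l + 1) * (2 * m) % 2 = 0 by grind]
    rcases l with - | l
    · simp
    · simp [det_stepToeplitz_zero]
  · rw [show (2 * l + 1) * (2 * m + 1) % 2 = 1 by grind, det_stepToeplitz_zero]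
    simp [← mul_pow]

theorem det_binomSumHankel_even_mul_add_one {l : ℕ} (hl : 0 < l) (q : ℕ) :
    (binomSumHankel ((2 * l + 1) * q + 1) (2 * l)).det =
      if Even q then 2 * (-1) ^ (((2 * l + 1) * q + 1) / 2) else 0 := by
  rw [det_binomSumHankel_even_eq_step (M := q) (δ := 1) (by push_cast; ring)
    (by rw [abs_one]; omega)]
  obtain ⟨l, rfl⟩ := Nat.exists_eq_add_one.2 hl
  rw [Nat.add_right_comm, det_stepToeplitz_one]
  split_ifs
  · simp [mul_comm]
  · simp

theorem det_binomSumHankel_even_mul_add_self {l : ℕ} (hl : 0 < l) (q : ℕ) :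
    (binomSumHankel ((2 * l + 1) * q + 2 * l) (2 * l)).det =
      if Even q then 2 * (-1) ^ (((2 * l + 1) * q + 2 * l) / 2) else 0 := by
  rw [det_binomSumHankel_even_eq_step (M := q + 1) (δ := -1) (by push_cast; ring)
    (by rw [abs_neg, abs_one]; omega)]
  obtain ⟨l, rfl⟩ := Nat.exists_eq_add_one.2 hl
  rw [Nat.add_right_comm, det_stepToeplitz_neg_one]
  simp only [Nat.even_add_one, ite_not]
  split_ifs
  · simp [mul_comm]
  · simp

theorem det_binomSumHankel_even_eq_zero (q : ℕ) {l e : ℕ} (he : 2 ≤ e) (hel : e < 2 * l) :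
    (binomSumHankel ((2 * l + 1) * q + e) (2 * l)).det = 0 := by
  rcases le_or_gt e l with h | h
  · rw [det_binomSumHankel_even_eq_step (M := q) (δ := e) (by push_cast; ring)
      (by rw [abs_of_nonneg] <;> omega),
      det_stepToeplitz_eq_zero _ _ (by rw [abs_of_nonneg] <;> omega) (by omega), mul_zero]
  · rw [det_binomSumHankel_even_eq_step (M := q + 1) (δ := e - (2 * l + 1)) (by push_cast; ring)
      (by rw [abs_of_nonpos] <;> omega),
      det_stepToeplitz_eq_zero _ _ (by rw [abs_of_nonpos] <;> omega) (by omega), mul_zero]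

theorem neg_one_pow_half_two_mul_add_one_mul_add (l q e : ℕ) :
    (-1 : ℤ) ^ (((2 * l + 1) * q + e) / 2) = ((-1) ^ q) ^ l * (-1) ^ ((q + e) / 2) := by
  rw [show (2 * l + 1) * q + e = q + e + 2 * (q * l) by ring, Nat.add_mul_div_left _ _ two_pos,
    pow_add, pow_mul, mul_comm]

theorem hankelCases_even_mul (l q : ℕ) :
    hankelCases ((2 * l + 1) * q) (2 * l) q = (-1) ^ ((2 * l + 1) * q / 2) := by
  have hsign := neg_one_pow_half_two_mul_add_one_mul_add l q 0
  rw [add_zero, add_zero] at hsign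
  rw [hankelCases, if_neg (by omega), if_neg (by omega), hsign]
  rcases q.even_or_odd with hq | hq
  · rw [if_pos ⟨rfl, even_two_mul l, hq⟩, hq.neg_one_pow, one_pow, one_mul]
  · rw [if_neg (by simp [hq]), if_pos ⟨rfl, even_two_mul l, hq⟩, hq.neg_one_pow, ← pow_add]
    have := Nat.odd_iff.1 hq
    congr 1
    omega

theorem hankelCases_even_mul_add_one (l q : ℕ) :
    hankelCases ((2 * l + 1) * q + 1) (2 * l) q =
      if Even q then 2 * (-1) ^ (((2 * l + 1) * q + 1) / 2) else 0 := by
  rw [hankelCases]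
  iterate 5 rw [if_neg (by grind)]
  rcases q.even_or_odd with hq | hq
  · have := Nat.even_iff.1 hq
    rw [if_pos ⟨rfl, even_two_mul l, hq⟩, if_pos hq, neg_one_pow_half_two_mul_add_one_mul_add,
      hq.neg_one_pow, one_pow, one_mul, show (q + 1) / 2 = q / 2 by omega]
  · simp [Nat.not_even_iff_odd.2 hq]

theorem hankelCases_even_mul_add_self {l : ℕ} (hl : 0 < l) (q : ℕ) :
    hankelCases ((2 * l + 1) * q + 2 * l) (2 * l) q =
      if Even q then 2 * (-1) ^ (((2 * l + 1) * q + 2 * l) / 2) else 0 := by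
  rw [hankelCases]
  iterate 7 rw [if_neg (by grind)]
  rcases q.even_or_odd with hq | hq
  · rw [if_pos ⟨rfl, even_two_mul l, hq⟩, if_pos hq, neg_one_pow_half_two_mul_add_one_mul_add,
      hq.neg_one_pow, one_pow, one_mul, add_comm q]
  · simp [Nat.not_even_iff_odd.2 hq]

theorem det_binomSumHankel_even (n l : ℕ) :
    (binomSumHankel n (2 * l)).det = hankelValue n (2 * l) := by
  obtain ⟨q, e, he, rfl⟩ : ∃ q e, e < 2 * l + 1 ∧ n = (2 * l + 1) * q + e :=
    ⟨_, _, Nat.mod_lt _ (by omega), (Nat.div_add_mod n _).symm⟩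
  rw [hankelValue_mul_add (2 * l) q he]
  obtain rfl | ⟨hl, rfl⟩ | ⟨hl, rfl⟩ | ⟨he₂, hel⟩ :
    e = 0 ∨ 0 < l ∧ e = 1 ∨ 0 < l ∧ e = 2 * l ∨ 2 ≤ e ∧ e < 2 * l := by omega
  · rw [add_zero, det_binomSumHankel_even_mul, hankelCases_even_mul]
  · rw [det_binomSumHankel_even_mul_add_one hl, hankelCases_even_mul_add_one]
  · rw [det_binomSumHankel_even_mul_add_self hl, hankelCases_even_mul_add_self hl]
  · rw [det_binomSumHankel_even_eq_zero q he₂ hel, hankelCases_eq_zero q he₂ hel]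

theorem det_binomSumHankel (n k : ℕ) : (binomSumHankel n k).det = hankelValue n k := by
  rcases Nat.even_or_odd' k with ⟨l, rfl | rfl⟩
  · exact det_binomSumHankel_even n l
  · exact det_binomSumHankel_odd n l

theorem binomSumHankel_one (n : ℕ) : binomSumHankel n 1 = Matrix.of fun i j : Fin n =>
    (((i : ℕ) + (j : ℕ) + 2).choose (((i : ℕ) + (j : ℕ) + 3) / 2) : ℤ) := by
  ext i j
  simp only [binomSumHankel, Matrix.of_apply, Finset.sum_range_succ, Finset.sum_range_zero,
    zero_add]
  generalize hm : (i : ℕ) + (j : ℕ) = m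
  have hlow : ((i : ℕ) + (j : ℕ) + 2 - (1 : ℕ) : ℤ) / 2 + (0 : ℕ) = ((m + 1) / 2 : ℕ) := by omega
  have hhigh : ((i : ℕ) + (j : ℕ) + 2 - (1 : ℕ) : ℤ) / 2 + (1 : ℕ) = ((m + 1) / 2 + 1 : ℕ) := by
    omega
  rw [hlow, hhigh, intBinom, intBinom, if_pos (Int.natCast_nonneg _),
    if_pos (Int.natCast_nonneg _), Int.toNat_natCast, Int.toNat_natCast,
    show (m + 3) / 2 = (m + 1) / 2 + 1 by omega,
    Nat.choose_succ_succ' (m + 1), Nat.cast_add]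

theorem hankelValue_one (n : ℕ) : hankelValue n 1 = n + 1 := by
  have := Nat.div_add_mod n 2
  rcases Nat.mod_two_eq_zero_or_one n with hn | hn
  · rw [hankelValue, hankelCases, if_pos (by omega)]
    omega
  · rw [hankelValue, hankelCases]
    iterate 4 rw [if_neg (by omega)]
    rw [if_pos ⟨by omega, odd_one⟩]
    omega

end Evaluation

theorem corollary14 :
    (∀ n k : ℕ, 0 < n → (binomSumHankel n k).det = hankelValue n k) ∧
    (∀ n : ℕ, 0 < n →
      (Matrix.of fun i j : Fin n =>
        (((i : ℕ) + (j : ℕ) + 2).choose (((i : ℕ) + (j : ℕ) + 3) / 2) : ℤ)).det = (n : ℤ) + 1) ∧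
    (∀ n : ℕ, 0 < n →
      (Matrix.of fun i j : Fin n =>
        (((i : ℕ) + (j : ℕ) + 2).choose (((i : ℕ) + (j : ℕ) + 2) / 2) : ℤ)).det = (n : ℤ) + 1) := by
  have hcentral (n : ℕ) : (Matrix.of fun i j : Fin n =>
      (((i : ℕ) + (j : ℕ) + 2).choose (((i : ℕ) + (j : ℕ) + 3) / 2) : ℤ)).det = n + 1 := by
    rw [← binomSumHankel_one, det_binomSumHankel, hankelValue_one]
  refine ⟨fun n k _ => det_binomSumHankel n k, fun n _ => hcentral n, fun n _ => ?_⟩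
  rw [← hcentral]
  congr 1
  ext i j
  exact congrArg Nat.cast (Nat.choose_symm_of_eq_add (by omega))
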